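/- For a finite extension $F/k$ of number fields write $F=k(\gamma)$ and let $\mathrm{Gal}(F/k)$ denote the Galois group of the minimal polynomial of $\gamma$ over $k$, regarded as a transitive permutation group on the $[F:k]$ roots of that polynomial in an algebraic closure of $k$; up to permutation isomorphism it does not depend on $\gamma$. (So $F/k$ need not be normal.) For a permutation group $H\le S_d$ let $C_2\wr H\cong C_2^d\rtimes H\le S_{2d}$ be the wreath product in its imprimitive action, i.e. the group of all permutations of $\{1,\dots,d\}\times\{1,2\}$ of the form $(i,l)\mapsto (h(i),a_i(l))$ with $h\in H$ and $a_1,\dots,a_d\in S_2=C_2$. Write $d_{L/K}$ for the relative discriminant ideal and $\mathrm{N}$ for the absolute norm of ideals. Let $k\subseteq K\subseteq L$ be number fields such that $\mathrm{Gal}(K/k)=H$ (up to permutation isomorphism), where $H\le S_d$, and $[L:K]=2$. Let $p$ be a prime number which is unramified in $K/k$, i.e. every prime ideal of $\mathcal{O}_K$ containing $p$ is unramified over $k$, and assume that $p$ exactly divides $\mathrm{N}(d_{L/K})$, i.e. $p\mid \mathrm{N}(d_{L/K})$ and $p^2\nmid \mathrm{N}(d_{L/K})$. Then $\mathrm{Gal}(L/k)=C_2\wr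 H$, up to permutation isomorphism. -/

import Mathlib

open NumberField IntermediateField

/-- The Galois group of an irreducible polynomial `f` over `k`, as a group of permutations of the
roots of `f` in an algebraic closure of `k`; here `f` is the minimal polynomial of `α`. If
`K = k(α)`, this is the Galois group of the (not necessarily normal) extension `K / k`,
as a transitive permutation group of degree `[K : k]`. -/
noncomputable def galPermGroup (k : Type*) [Field k] {K : Type*} [Field K] [Algebra k K] (α : K) :
    Subgroup (Equiv.Perm ((minpoly k α).rootSet (AlgebraicClosure k))) :=
  haveI : Fact (((minpoly k α).map (algebraMap k (AlgebraicClosure k))).Splits) :=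
    ⟨IsAlgClosed.splits _⟩
  (Polynomial.Gal.galActionHom (minpoly k α) (AlgebraicClosure k)).range

/-- Two permutation groups are permutation isomorphic: some bijection of the underlying sets
carries one onto the other by transport of permutations. -/
def IsPermIsomorphic {Ω Ω' : Type*} (G : Subgroup (Equiv.Perm Ω))
    (G' : Subgroup (Equiv.Perm Ω')) : Prop :=
  ∃ e : Ω ≃ Ω', G.map (e.permCongrHom : Equiv.Perm Ω →* Equiv.Perm Ω') = G'

/-- The (imprimitive) wreath product `A ≀ H` of permutation groups `A` on `Λ` and `H` on `Δ`:
the permutations of `Δ × Λ` of the form `(i, l) ↦ (h i, a i l)` with `h ∈ H` and with `a i ∈ A`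
for every `i`. It permutes the blocks `{i} × Λ` through `H`. -/
def wreathProduct {Λ Δ : Type*} (A : Subgroup (Equiv.Perm Λ)) (H : Subgroup (Equiv.Perm Δ)) :
    Subgroup (Equiv.Perm (Δ × Λ)) where
  carrier := {σ | ∃ h ∈ H, ∃ a : Δ → Equiv.Perm Λ, (∀ i, a i ∈ A) ∧
    ∀ i l, σ (i, l) = (h i, a i l)}
  one_mem' := ⟨1, H.one_mem, fun _ => 1, fun _ => A.one_mem, fun _ _ => rfl⟩
  mul_mem' := by
    rintro σ τ ⟨h, hh, a, ha, hσ⟩ ⟨g, hg, b, hb, hτ⟩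
    refine ⟨h * g, H.mul_mem hh hg, fun i => a (g i) * b i,
      fun i => A.mul_mem (ha _) (hb _), fun i l => ?_⟩
    simp [hσ, hτ]
  inv_mem' := by
    rintro σ ⟨h, hh, a, ha, hσ⟩
    refine ⟨h⁻¹, H.inv_mem hh, fun i => (a (h⁻¹ i))⁻¹, fun i => A.inv_mem (ha _),
      fun i l => ?_⟩
    rw [Equiv.Perm.inv_eq_iff_eq, hσ]
    simp

/-- The relative discriminant `d_{L/K}`, an ideal of `𝓞 K`: the ideal norm of the different. -/
noncomputable def relDiscr (K L : Type*) [Field K] [NumberField K] [Field L] [NumberField L]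
    [Algebra K L] : Ideal (𝓞 K) :=
  Ideal.relNorm (𝓞 K) (differentIdeal (𝓞 K) (𝓞 L))

/-!
Write `Ω` for an algebraic closure of `k` and `Γ = Gal(Ω/k)`. The permutation groups in question are
the images of `Γ` acting on the `k`-embeddings of `K` and of `L` into `Ω`
(`isPermIsomorphic_range_embeddingPerm_galPermGroup`). Restriction maps the embeddings of `L`
equivariantly onto those of `K`, with fibres of two elements, so the group of `L` always lies in
`C₂ ≀ H`. It is everything as soon as some `σ ∈ Γ` swaps the two points of one fibre and fixes all
other embeddings of `L`: by transitivity the swap of each single fibre is then in the image, and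
these swaps generate the kernel `C₂ ^ d` of `C₂ ≀ H → H` (`isPermIsomorphic_wreathProduct`).

Such a `σ` comes from an inertia group. As `p` exactly divides the norm of the different of `L/K`,
exactly one prime `P` of `L` above `p` is ramified over `K`, and its residue field is `𝔽_p`. Let
`E/k` be a finite Galois extension containing `L`, and `Q` a prime of `E` above `P`.

* Multiplicativity of ramification indices gives `g` in the inertia group of `Q` over `K` which
  moves `L` (`NumberField.exists_mem_inertia_apply_ne`).
* Two embeddings of a number field `M` into `E` that agree on `F ⊆ M` and are congruent modulo `Q`
  are equal, provided the prime of `M` below `Q` is unramified over `F`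
  (`NumberField.ringHom_ext_of_isUnramifiedAt`). This follows from uniqueness of lifts along
  formally unramified maps and Krull's intersection theorem, and is used three times. An embedding of `K`
  and its composite with `g` are congruent modulo `Q`, so `g` fixes every embedding of `K`. In the
  same way `g` fixes every embedding `ψ` of `L` under which `Q` does not lie above `P`. Finally, if
  `Q` lies above `P` under `ψ`, then the restriction of `ψ` to `K` and the inclusion `K ⊆ E` are
  congruent modulo `Q`, because every integer of `K` is congruent to a rational integer modulo `P`; hence
  they are equal, and `ψ` belongs to the fibre of the inclusion `L ⊆ E`.
-/

/-! ### Rigidity of homomorphisms at unramified primes -/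

/-- Two homomorphisms from `A` to a Noetherian domain that agree on `R` and are congruent modulo a
prime `Q` are equal if `A` is unramified over `R` at the preimage of `Q`: formal unramifiedness
makes them congruent modulo all powers of `Q` in the local ring at `Q`. -/
theorem RingHom.ext_of_isUnramifiedAt {R A B : Type*} [CommRing R] [CommRing A] [CommRing B]
    [Algebra R A] [IsNoetherianRing B] [IsDomain B] {f g : A →+* B} (Q : Ideal B) [Q.IsPrime]
    (hR : f.comp (algebraMap R A) = g.comp (algebraMap R A))
    (hunr : Algebra.IsUnramifiedAt R (Q.comap f)) (hQ : ∀ a, f a - g a ∈ Q) : f = g := by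
  let : Algebra R B := (f.comp (algebraMap R A)).toAlgebra
  let P := Q.comap f
  let C := Localization.AtPrime Q
  have hPg : P = Q.comap g := by
    ext a
    rw [Ideal.mem_comap, Ideal.mem_comap]
    exact ⟨fun h => by simpa using Q.sub_mem h (hQ a), fun h => by simpa using Q.add_mem (hQ a) h⟩
  -- both homomorphisms extend to the localization of `A` at `P`, with values in that of `B` at `Q`
  have key : ∀ (u : A →+* B), P = Q.comap u → ∀ y : P.primeCompl,
      IsUnit (((algebraMap B C).comp u) y) := fun u hu y =>
    IsLocalization.map_units C (⟨u y, fun h => y.2 (hu.ge h)⟩ : Q.primeCompl)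
  have hR' : ∀ r, g (algebraMap R A r) = algebraMap R B r := fun r =>
    (RingHom.congr_fun hR r).symm
  let f₀ : A →ₐ[R] C := { (algebraMap B C).comp f with
    commutes' := fun r => by rw [IsScalarTower.algebraMap_apply R B C]; rfl }
  let g₀ : A →ₐ[R] C := { (algebraMap B C).comp g with
    commutes' := fun r => by
      rw [IsScalarTower.algebraMap_apply R B C, ← hR']; rfl }
  let f₁ : Localization.AtPrime P →ₐ[R] C :=
    IsLocalization.liftAlgHom (M := P.primeCompl) (f := f₀) (key f rfl)
  let g₁ : Localization.AtPrime P →ₐ[R] C :=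
    IsLocalization.liftAlgHom (M := P.primeCompl) (f := g₀) (key g hPg)
  have hf₁ : ∀ a, f₁ (algebraMap A _ a) = algebraMap B C (f a) := fun a =>
    IsLocalization.lift_eq _ a
  have hg₁ : ∀ a, g₁ (algebraMap A _ a) = algebraMap B C (g a) := fun a =>
    IsLocalization.lift_eq _ a
  let I := IsLocalRing.maximalIdeal C
  have : IsNoetherianRing C := IsLocalization.isNoetherianRing Q.primeCompl C inferInstance
  have hI : ⨅ i : ℕ, I ^ i = ⊥ :=
    Ideal.iInf_pow_eq_bot_of_isLocalRing I (IsLocalRing.maximalIdeal.isMaximal C).ne_top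
  have hres : ((Ideal.Quotient.mk I).comp (f₁ : Localization.AtPrime P →+* C)) =
      (Ideal.Quotient.mk I).comp (g₁ : Localization.AtPrime P →+* C) := by
    refine IsLocalization.ringHom_ext P.primeCompl (RingHom.ext fun a => ?_)
    simp only [RingHom.comp_apply, RingHom.coe_coe, hf₁, hg₁]
    rw [Ideal.Quotient.eq, ← map_sub]
    exact (IsLocalization.AtPrime.to_map_mem_maximal_iff C Q _).2 (hQ a)
  have : Algebra.FormallyUnramified R (Localization.AtPrime P) := hunr
  have h₁ : f₁ = g₁ := Algebra.FormallyUnramified.ext_of_iInf I hI (RingHom.congr_fun hres)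
  ext a
  apply IsLocalization.injective C Q.primeCompl_le_nonZeroDivisors
  rw [← hf₁, ← hg₁, h₁]

theorem NumberField.ringHom_ext_of_isUnramifiedAt {F M E : Type*} [Field F] [Field M] [Field E]
    [NumberField F] [NumberField M] [NumberField E] [Algebra F M] {f g : M →+* E}
    (Q : Ideal (𝓞 E)) [Q.IsPrime]
    (hF : f.comp (algebraMap F M) = g.comp (algebraMap F M))
    (hunr : Algebra.IsUnramifiedAt (𝓞 F) (Q.comap (RingOfIntegers.mapRingHom f)))
    (hQ : ∀ a, RingOfIntegers.mapRingHom f a - RingOfIntegers.mapRingHom g a ∈ Q) : f = g := by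
  have h : RingOfIntegers.mapRingHom f = RingOfIntegers.mapRingHom g := by
    refine RingHom.ext_of_isUnramifiedAt (R := 𝓞 F) Q ?_ hunr hQ
    ext x
    exact RingHom.congr_fun hF x
  refine IsFractionRing.injective_comp_algebraMap (A := 𝓞 M) (L := E) ?_
  ext x
  exact congrArg (algebraMap (𝓞 E) E) (RingHom.congr_fun h x)

/-! ### The ramified prime above `p` -/

theorem Ideal.exists_absNorm_eq_pow_of_natCast_mem {S : Type*} [CommRing S] [IsDedekindDomain S]
    [Module.Free ℤ S] [Module.Finite ℤ S] {p : ℕ} (hp : p.Prime) (P : Ideal S) [P.IsMaximal]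
    (hpP : (p : S) ∈ P) : ∃ n, 0 < n ∧ Ideal.absNorm P = p ^ n := by
  obtain ⟨q, n, hn, hqP, hq, h⟩ := Ideal.exists_prime_and_absNorm_eq_pow P
  obtain rfl : p = q := by
    by_contra hpq
    refine (inferInstance : P.IsMaximal).ne_top ((Ideal.eq_top_iff_one P).2 ?_)
    obtain ⟨u, v, huv⟩ := Nat.isCoprime_iff_coprime.2 ((Nat.coprime_primes hp hq).2 hpq)
    have := congrArg (Int.cast : ℤ → S) huv
    push_cast at this
    rw [← this]
    exact P.add_mem (P.mul_mem_left _ hpP) (P.mul_mem_left _ hqP)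
  exact ⟨n, hn, h⟩

/-- An ideal whose norm is exactly divisible by `p` has exactly one prime divisor containing `p`,
and that divisor has norm `p`. -/
theorem Ideal.exists_unique_prime_of_prime_exactly_dvd_absNorm {S : Type*} [CommRing S]
    [IsDedekindDomain S] [CharZero S] [Module.Free ℤ S] [Module.Finite ℤ S]
    {p : ℕ} (hp : p.Prime) {D : Ideal S}
    (hD : p ∣ Ideal.absNorm D) (hD' : ¬ p ^ 2 ∣ Ideal.absNorm D) :
    ∃ P : Ideal S, P.IsMaximal ∧ (p : S) ∈ P ∧ Ideal.absNorm P = p ∧ P ∣ D ∧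
      ∀ P' : Ideal S, P'.IsPrime → (p : S) ∈ P' → P' ∣ D → P' = P := by
  obtain ⟨P, hP, hPp, hPD⟩ := Ideal.exists_isMaximal_dvd_of_dvd_absNorm' hp D hD
  have hpP : (p : S) ∈ P := by
    have : (p : ℤ) ∈ P.under ℤ := by rw [hPp]; exact Ideal.mem_span_singleton_self _
    simpa [Ideal.mem_comap] using this
  obtain ⟨n, hn, hPn⟩ := Ideal.exists_absNorm_eq_pow_of_natCast_mem hp P hpP
  refine ⟨P, hP, hpP, ?_, hPD, ?_⟩
  · have h1 : ¬ 2 ≤ n := fun h => hD' <|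
      ((pow_dvd_pow p h).trans hPn.symm.dvd).trans (map_dvd Ideal.absNorm hPD)
    obtain rfl : n = 1 := by omega
    simpa using hPn
  · intro P' hP' hpP' hP'D
    by_contra hne
    have hbot : P' ≠ ⊥ := by
      rintro rfl
      exact hp.ne_zero (by simpa using hpP')
    have hmax : P'.IsMaximal := hP'.isMaximal hbot
    obtain ⟨m, hm, hPm⟩ := Ideal.exists_absNorm_eq_pow_of_natCast_mem hp P' hpP'
    have hcop : IsCoprime P' P := Ideal.isCoprime_of_isMaximal hne
    have h := map_dvd Ideal.absNorm (hcop.mul_dvd hP'D hPD)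
    rw [map_mul, hPn, hPm, ← pow_add] at h
    exact hD' ((pow_dvd_pow p (by omega)).trans h)

theorem Ideal.exists_sub_intCast_mem_of_absNorm_prime {S : Type*} [CommRing S]
    [IsDedekindDomain S] [Module.Free ℤ S] [Module.Finite ℤ S] {P : Ideal S}
    (hP : (Ideal.absNorm P).Prime) (x : S) : ∃ n : ℤ, x - n ∈ P := by
  have : Fact (Ideal.absNorm P).Prime := ⟨hP⟩
  have hne : (1 : S ⧸ P) ≠ 0 := fun h => hP.ne_one <| Ideal.absNorm_eq_one_iff.2 <|
    (Ideal.eq_top_iff_one P).2 (Ideal.Quotient.eq_zero_iff_mem.1 (by simpa using h))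
  have hcard : Nat.card (S ⧸ P) = Ideal.absNorm P := rfl
  have htop := zmultiples_eq_top_of_prime_card hcard hne
  obtain ⟨n, hn⟩ := AddSubgroup.mem_zmultiples_iff.1
    (htop ▸ AddSubgroup.mem_top (Ideal.Quotient.mk P x))
  refine ⟨n, Ideal.Quotient.eq.1 ?_⟩
  rw [← hn]
  simp

/-! ### Inertia -/

/-- If `P` is ramified over `K`, then the inertia group over `K` of a prime above `P` does not fix
`L` pointwise: its order `e(Q|P) * e(P|K)` exceeds the order `e(Q|P)` of the inertia group over
`L`. -/
theorem NumberField.exists_mem_inertia_apply_ne {K L E : Type*} [Field K] [Field L] [Field E]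
    [NumberField K] [NumberField L] [NumberField E] [Algebra K L] [Algebra L E] [Algebra K E]
    [IsScalarTower K L E] [IsGalois K E] (P : Ideal (𝓞 L)) [P.IsPrime]
    (hP : ¬ Algebra.IsUnramifiedAt (𝓞 K) P)
    (Q : Ideal (𝓞 E)) [Q.IsPrime] [Q.LiesOver P] :
    ∃ g ∈ Q.inertia (E ≃ₐ[K] E), ∃ y : L, g (algebraMap L E y) ≠ algebraMap L E y := by
  by_contra! hcon
  have : IsGalois L E := IsGalois.tower_top_of_isGalois K L E
  have hK := Ideal.card_inertia_eq_ramificationIdxIn (G := E ≃ₐ[K] E) (Q.under (𝓞 K)) Q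
  have hL := Ideal.card_inertia_eq_ramificationIdxIn (G := E ≃ₐ[L] E) P Q
  rw [Ideal.ramificationIdxIn_eq_ramificationIdx _ Q (E ≃ₐ[K] E)] at hK
  rw [Ideal.ramificationIdxIn_eq_ramificationIdx _ Q (E ≃ₐ[L] E)] at hL
  have htower := Ideal.ramificationIdx_tower (R := 𝓞 K) P Q
  -- if the inertia group over `K` fixes `L`, it embeds into the one over `L`
  let f : Q.inertia (E ≃ₐ[K] E) → Q.inertia (E ≃ₐ[L] E) := fun g =>
    ⟨AlgEquiv.ofRingEquiv (f := (g.1 : E ≃+* E)) (hcon g.1 g.2), g.2⟩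
  have hf : Function.Injective f := fun g g' h => Subtype.ext <| AlgEquiv.ext fun x =>
    AlgEquiv.congr_fun (congrArg Subtype.val h) x
  have hle := Nat.card_le_card_of_injective f hf
  rw [hK, hL, htower] at hle
  have h1 := P.ramificationIdx_pos (𝓞 K)
  have h2 := Q.ramificationIdx_pos (𝓞 L)
  have h3 : P.ramificationIdx (𝓞 K) = 1 := by nlinarith
  exact hP ((Ideal.ramificationIdx_eq_one_iff).1 h3)

/-- If `K/k` is unramified above `p` and `p` exactly divides the norm of the different of `L/K`,
then some automorphism of a Galois extension `E/k` containing `L` moves `L`, but fixes all embeddings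
of `K` and all embeddings of `L` that do not restrict to the inclusion of `K`. -/
theorem NumberField.exists_algEquiv_moving_one_fiber {k K L E : Type*} [Field k] [Field K]
    [Field L] [Field E] [NumberField k] [NumberField K] [NumberField L] [NumberField E]
    [Algebra k K] [Algebra k L] [Algebra k E] [Algebra K L] [Algebra K E] [Algebra L E]
    [IsScalarTower k K L] [IsScalarTower K L E] [IsScalarTower k K E] [IsGalois k E]
    {p : ℕ} (hp : p.Prime)
    (hunram : ∀ P : Ideal (𝓞 K), ∀ _ : P.IsPrime, (p : 𝓞 K) ∈ P → Algebra.IsUnramifiedAt (𝓞 k) P)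
    (hdvd : p ∣ Ideal.absNorm (differentIdeal (𝓞 K) (𝓞 L)))
    (hndvd : ¬ p ^ 2 ∣ Ideal.absNorm (differentIdeal (𝓞 K) (𝓞 L))) :
    ∃ g : E ≃ₐ[k] E, (∃ y : L, g (algebraMap L E y) ≠ algebraMap L E y) ∧
      (∀ (φ : K →ₐ[k] E) (x : K), g (φ x) = φ x) ∧
      ∀ ψ : L →ₐ[k] E, (∃ x : K, ψ (algebraMap K L x) ≠ algebraMap K E x) →
        ∀ y, g (ψ y) = ψ y := by
  obtain ⟨P, hPmax, hpP, hPp, hPD, huniq⟩ :=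
    Ideal.exists_unique_prime_of_prime_exactly_dvd_absNorm hp hdvd hndvd
  have hPram : ¬ Algebra.IsUnramifiedAt (𝓞 K) P := dvd_differentIdeal_iff.1 hPD
  obtain ⟨⟨Q, hQ, hQP⟩⟩ := (inferInstance : Nonempty (P.primesOver (𝓞 E)))
  have : IsGalois K E := IsGalois.tower_top_of_isGalois k K E
  obtain ⟨g, hg, hmove⟩ := exists_mem_inertia_apply_ne P hPram Q
  have hpQ : (p : 𝓞 E) ∈ Q := by
    have := (Ideal.mem_of_liesOver Q P (p : 𝓞 L)).1 hpP
    simpa using this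
  have hpcomap : ∀ (f : K →+* E), (p : 𝓞 K) ∈ Q.comap (RingOfIntegers.mapRingHom f) := fun f => by
    simpa [Ideal.mem_comap] using hpQ
  have hK : ∀ (φ : K →ₐ[k] E) (x : K), g (φ x) = φ x := by
    intro φ x
    refine RingHom.congr_fun (NumberField.ringHom_ext_of_isUnramifiedAt (F := k)
      (f := ((g : E →+* E).comp (φ : K →+* E))) (g := φ) Q ?_ (hunram _ inferInstance (hpcomap _))
      fun a => hg (RingOfIntegers.mapRingHom (φ : K →+* E) a)) x
    ext z
    have hz := (g.restrictScalars k).commutes z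
    simpa only [RingHom.comp_apply, RingHom.coe_coe, AlgHom.commutes] using! hz
  refine ⟨g.restrictScalars k, hmove, hK, ?_⟩
  rintro ψ ⟨x, hx⟩ y
  have hψK : ∀ x : K, ψ (algebraMap K L x) = g (ψ (algebraMap K L x)) := fun x =>
    (hK (ψ.comp (IsScalarTower.toAlgHom k K L)) x).symm
  refine (RingHom.congr_fun (NumberField.ringHom_ext_of_isUnramifiedAt (F := K)
      (f := (ψ : L →+* E)) (g := (g : E →+* E).comp (ψ : L →+* E)) Q (RingHom.ext hψK) ?_
      fun a => ?_) y).symm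
  · -- otherwise `Q` lies above `P` under `ψ`, and `ψ` restricts to the inclusion of `K`
    rw [← not_dvd_differentIdeal_iff]
    intro hdvd'
    have hcomap := huniq _ inferInstance (by simpa [Ideal.mem_comap] using hpQ) hdvd'
    refine hx (RingHom.congr_fun (NumberField.ringHom_ext_of_isUnramifiedAt (F := k)
      (f := (ψ : L →+* E).comp (algebraMap K L)) (g := algebraMap K E) Q ?_
      (hunram _ inferInstance (hpcomap _)) fun a => ?_) x)
    · ext z
      simp [← IsScalarTower.algebraMap_apply]
    · -- the residue field of `P` is `𝔽_p`, on which all embeddings agree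
      obtain ⟨n, hn⟩ := Ideal.exists_sub_intCast_mem_of_absNorm_prime (hPp ▸ hp)
        (algebraMap (𝓞 K) (𝓞 L) a)
      have h₁ : RingOfIntegers.mapRingHom (ψ : L →+* E) (algebraMap (𝓞 K) (𝓞 L) a - n) ∈ Q := by
        rw [← hcomap] at hn
        exact hn
      have h₂ := (Ideal.mem_of_liesOver Q P _).1 hn
      have h := Q.sub_mem h₁ h₂
      rw [map_sub, map_sub, map_intCast, map_intCast, sub_sub_sub_cancel_right,
        ← IsScalarTower.algebraMap_apply] at h
      exact h
  · rw [← neg_sub]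
    exact Q.neg_mem (hg (RingOfIntegers.mapRingHom (ψ : L →+* E) a))

/-! ### Permutation isomorphisms and the action on embeddings -/

theorem IsPermIsomorphic.symm {Ω Ω' : Type*} {G : Subgroup (Equiv.Perm Ω)}
    {G' : Subgroup (Equiv.Perm Ω')} (h : IsPermIsomorphic G G') : IsPermIsomorphic G' G := by
  obtain ⟨e, rfl⟩ := h
  refine ⟨e.symm, ?_⟩
  rw [Subgroup.map_map]
  convert! Subgroup.map_id G
  ext; simp [Equiv.permCongrHom]

theorem IsPermIsomorphic.trans {Ω Ω' Ω'' : Type*} {G : Subgroup (Equiv.Perm Ω)}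
    {G' : Subgroup (Equiv.Perm Ω')} {G'' : Subgroup (Equiv.Perm Ω'')}
    (h : IsPermIsomorphic G G') (h' : IsPermIsomorphic G' G'') : IsPermIsomorphic G G'' := by
  obtain ⟨e, rfl⟩ := h
  obtain ⟨e', rfl⟩ := h'
  exact ⟨e.trans e', by rw [Subgroup.map_map]; rfl⟩

/-- The action of `Gal(Ω/k)` on the `k`-embeddings of `K` into `Ω` by composition, as a permutation
representation. -/
def embeddingPerm (k K Ω : Type*) [Field k] [Field K] [Field Ω] [Algebra k K] [Algebra k Ω] :
    (Ω ≃ₐ[k] Ω) →* Equiv.Perm (K →ₐ[k] Ω) where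
  toFun σ :=
    { toFun := fun φ => (σ : Ω →ₐ[k] Ω).comp φ
      invFun := fun φ => (σ.symm : Ω →ₐ[k] Ω).comp φ
      left_inv := fun φ => by ext; simp
      right_inv := fun φ => by ext; simp }
  map_one' := by ext; rfl
  map_mul' _ _ := by ext; rfl

@[simp]
theorem embeddingPerm_apply_apply {k K Ω : Type*} [Field k] [Field K] [Field Ω] [Algebra k K]
    [Algebra k Ω] (σ : Ω ≃ₐ[k] Ω) (φ : K →ₐ[k] Ω) (x : K) :
    embeddingPerm k K Ω σ φ x = σ (φ x) := rfl

/-- Evaluation at a primitive element identifies the action on embeddings with the action on the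
roots of its minimal polynomial. -/
theorem isPermIsomorphic_range_embeddingPerm_galPermGroup {k K : Type*} [Field k] [Field K]
    [Algebra k K] [FiniteDimensional k K] {α : K} (hα : k⟮α⟯ = ⊤) :
    IsPermIsomorphic (embeddingPerm k K (AlgebraicClosure k)).range (galPermGroup k α) := by
  have : Fact (((minpoly k α).map (algebraMap k (AlgebraicClosure k))).Splits) :=
    ⟨IsAlgClosed.splits _⟩
  have hint : IsIntegral k α := IsIntegral.of_finite k α
  have hne : minpoly k α ≠ 0 := minpoly.ne_zero hint
  let ev : (K →ₐ[k] AlgebraicClosure k) → (minpoly k α).rootSet (AlgebraicClosure k) := fun φ =>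
    ⟨φ α, Polynomial.mem_rootSet.2
      ⟨hne, by rw [Polynomial.aeval_algHom_apply, minpoly.aeval, map_zero]⟩⟩
  have hinj : Function.Injective ev := fun φ φ' h => by
    refine AlgHom.ext_of_adjoin_eq_top (s := {α}) ?_ ?_
    · rw [← IntermediateField.adjoin_simple_toSubalgebra_of_isAlgebraic hint.isAlgebraic, hα]
      rfl
    · rintro _ rfl
      exact congrArg Subtype.val h
  have hsurj : Function.Surjective ev := fun ⟨y, hy⟩ => by
    rw [← Algebra.IsAlgebraic.range_eval_eq_rootSet_minpoly] at hy
    obtain ⟨φ, rfl⟩ := hy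
    exact ⟨φ, rfl⟩
  let e := Equiv.ofBijective ev ⟨hinj, hsurj⟩
  have key : ∀ σ : AlgebraicClosure k ≃ₐ[k] AlgebraicClosure k,
      e.permCongrHom (embeddingPerm k K _ σ) = Polynomial.Gal.galActionHom (minpoly k α) _
        (Polynomial.Gal.restrict (minpoly k α) _ σ) := fun σ => by
    ext y
    obtain ⟨φ, rfl⟩ := e.surjective y
    rw [Polynomial.Gal.galActionHom_restrict]
    simp [Equiv.permCongrHom]
    rfl
  refine ⟨e, ?_⟩
  ext τ
  constructor
  · rintro ⟨_, ⟨σ, rfl⟩, rfl⟩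
    exact ⟨_, (key σ).symm⟩
  · rintro ⟨s, rfl⟩
    obtain ⟨σ, rfl⟩ := Polynomial.Gal.restrict_surjective (minpoly k α) (AlgebraicClosure k) s
    exact ⟨_, ⟨σ, rfl⟩, key σ⟩

theorem exists_embeddingPerm_apply_eq {k K : Type*} [Field k] [Field K] [Algebra k K]
    [FiniteDimensional k K] (φ φ' : K →ₐ[k] AlgebraicClosure k) :
    ∃ σ, embeddingPerm k K (AlgebraicClosure k) σ φ = φ' := by
  let := (φ : K →+* AlgebraicClosure k).toAlgebra
  have : IsScalarTower k K (AlgebraicClosure k) := .of_algebraMap_eq fun x => (φ.commutes x).symm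
  have : Algebra.IsAlgebraic K (AlgebraicClosure k) := .tower_top (K := k) K
  obtain ⟨τ, hτ⟩ : ∃ τ : AlgebraicClosure k →ₐ[k] AlgebraicClosure k, τ.comp φ = φ' :=
    IsAlgClosed.surjective_domRestrict_of_isAlgebraic (L := K) φ'
  exact ⟨AlgEquiv.ofBijective τ (Algebra.IsAlgebraic.algHom_bijective τ), hτ⟩

theorem card_fiber_restriction {k K L : Type*} [Field k] [Field K] [Field L] [CharZero K]
    [Algebra k K] [Algebra k L] [Algebra K L] [IsScalarTower k K L] [FiniteDimensional K L]
    (φ : K →ₐ[k] AlgebraicClosure k) :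
    Nat.card {ψ : L →ₐ[k] AlgebraicClosure k // ψ.comp (IsScalarTower.toAlgHom k K L) = φ} =
      Module.finrank K L := by
  let := (φ : K →+* AlgebraicClosure k).toAlgebra
  have : IsScalarTower k K (AlgebraicClosure k) := .of_algebraMap_eq fun x => (φ.commutes x).symm
  rw [← AlgHom.card K L (AlgebraicClosure k), ← Nat.card_eq_fintype_card]
  exact Nat.card_congr
    { toFun := fun ψ => { (ψ.1 : L →+* AlgebraicClosure k) with
        commutes' := fun x => AlgHom.congr_fun ψ.2 x }
      invFun := fun ψ => ⟨ψ.restrictScalars k, AlgHom.ext ψ.commutes⟩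
      left_inv := fun _ => rfl
      right_inv := fun _ => rfl }

/-- The automorphism of `NumberField.exists_algEquiv_moving_one_fiber`, for `E` the normal closure
of `L/k`, extended to the algebraic closure. -/
theorem exists_embeddingPerm_moving_one_fiber {k K L : Type*} [Field k] [Field K] [Field L]
    [NumberField k] [NumberField K] [NumberField L] [Algebra k K] [Algebra k L]
    [Algebra K L] [IsScalarTower k K L]
    {p : ℕ} (hp : p.Prime)
    (hunram : ∀ P : Ideal (𝓞 K), ∀ _ : P.IsPrime, (p : 𝓞 K) ∈ P → Algebra.IsUnramifiedAt (𝓞 k) P)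
    (hdvd : p ∣ Ideal.absNorm (differentIdeal (𝓞 K) (𝓞 L)))
    (hndvd : ¬ p ^ 2 ∣ Ideal.absNorm (differentIdeal (𝓞 K) (𝓞 L))) :
    ∃ (σ : AlgebraicClosure k ≃ₐ[k] AlgebraicClosure k) (ψ₀ : L →ₐ[k] AlgebraicClosure k),
      embeddingPerm k L _ σ ψ₀ ≠ ψ₀ ∧ embeddingPerm k K _ σ = 1 ∧
      ∀ ψ : L →ₐ[k] AlgebraicClosure k, ψ.comp (IsScalarTower.toAlgHom k K L) ≠
        ψ₀.comp (IsScalarTower.toAlgHom k K L) → embeddingPerm k L _ σ ψ = ψ := by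
  let E := normalClosure k L (AlgebraicClosure k)
  have : FiniteDimensional k L := .right ℚ k L
  have : NumberField E := .of_module_finite k E
  have : IsGalois k E := ⟨⟩
  have hE : ∀ ψ : L →ₐ[k] AlgebraicClosure k, ∃ ψ' : L →ₐ[k] E, E.val.comp ψ' = ψ := fun ψ =>
    ⟨ψ.codRestrict E.toSubalgebra fun y => ψ.fieldRange_le_normalClosure ⟨y, rfl⟩, rfl⟩
  let ψ₀ : L →ₐ[k] AlgebraicClosure k := IsAlgClosed.lift
  obtain ⟨ι, hι⟩ := hE ψ₀
  let : Algebra L E := (ι : L →+* E).toAlgebra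
  let : Algebra K E := ((ι : L →+* E).comp (algebraMap K L)).toAlgebra
  have : IsScalarTower K L E := .of_algebraMap_eq fun _ => rfl
  have : IsScalarTower k K E := .of_algebraMap_eq fun x => by
    rw [← ι.commutes x, IsScalarTower.algebraMap_apply k K L]
    rfl
  obtain ⟨g, ⟨y, hy⟩, hgK, hgL⟩ :=
    NumberField.exists_algEquiv_moving_one_fiber (E := E) hp hunram hdvd hndvd
  obtain ⟨σ, hσ⟩ := AlgEquiv.restrictNormalHom_surjective (F := k) (K₁ := E) (AlgebraicClosure k) g
  have hσE : ∀ z : E, σ (z : AlgebraicClosure k) = (g z : E) := fun z => by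
    rw [← hσ]
    exact (AlgEquiv.restrictNormal_commutes σ E z).symm
  refine ⟨σ, ψ₀, fun h => hy ?_, ?_, ?_⟩
  · have h' := AlgHom.congr_fun h y
    rw [embeddingPerm_apply_apply, ← hι] at h'
    exact Subtype.ext ((hσE (ι y)).symm.trans h')
  · -- every embedding of `K` into the algebraic closure extends to `L`, so it takes values in `E`
    ext φ x
    have : FiniteDimensional K L := .right k K L
    obtain ⟨ψ, hψ⟩ : ∃ ψ : L →ₐ[k] AlgebraicClosure k,
        ψ.comp (IsScalarTower.toAlgHom k K L) = φ := by
      have h := card_fiber_restriction (L := L) φ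
      have hpos : 0 < Module.finrank K L := Module.finrank_pos
      rw [← h] at hpos
      obtain ⟨⟨ψ, hψ⟩⟩ := (Nat.card_pos_iff.1 hpos).1
      exact ⟨ψ, hψ⟩
    obtain ⟨ψ', rfl⟩ := hE ψ
    subst hψ
    exact (hσE _).trans (congrArg Subtype.val (hgK (ψ'.comp (IsScalarTower.toAlgHom k K L)) x))
  · intro ψ hψ
    obtain ⟨ψ', rfl⟩ := hE ψ
    ext z
    refine (hσE _).trans (congrArg Subtype.val (hgL ψ' ?_ z))
    by_contra! hcon
    refine hψ (AlgHom.ext fun x => ?_)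
    rw [← hι]
    exact congrArg Subtype.val (hcon x)

/-! ### Generating the wreath product -/

theorem eq_of_ne_of_card_fiber_eq_two {X Y : Type*} {π : X → Y}
    (hcard : ∀ y, Nat.card {x // π x = y} = 2) {x a b : X} (ha : π a = π x) (hb : π b = π x)
    (hax : a ≠ x) (hbx : b ≠ x) : a = b := by
  obtain ⟨⟨c, hc⟩, ⟨d, hd⟩, -, hcd⟩ := Nat.card_eq_two_iff.1 (hcard (π x))
  have hmem : ∀ z, π z = π x → z = c ∨ z = d := fun z hz => by
    have : (⟨z, hz⟩ : {z // π z = π x}) ∈ ({⟨c, hc⟩, ⟨d, hd⟩} : Set _) := hcd ▸ Set.mem_univ _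
    simpa using this
  have h1 := hmem x rfl
  have h2 := hmem a ha
  have h3 := hmem b hb
  grind

/-- The permutations preserving every fibre of a map with two-point fibres are generated by the
swaps of single fibres. -/
theorem Equiv.Perm.mem_of_preserves_fibers {X Y : Type*} [Finite Y] {π : X → Y}
    (hcard : ∀ y, Nat.card {x // π x = y} = 2) {G : Subgroup (Equiv.Perm X)}
    (hG : ∀ y, ∃ s ∈ G, (∀ x, π (s x) = π x) ∧ (∀ x, π x ≠ y → s x = x) ∧
      ∀ x, π x = y → s x ≠ x)
    (τ : Equiv.Perm X) (hτ : ∀ x, π (τ x) = π x) : τ ∈ G := by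
  classical
  have := Fintype.ofFinite Y
  -- induction on a set of fibres outside of which `τ` is trivial
  suffices h : ∀ (S : Finset Y) (τ : Equiv.Perm X), (∀ x, π (τ x) = π x) →
      (∀ x, π x ∉ S → τ x = x) → τ ∈ G from h Finset.univ τ hτ (by simp)
  intro S
  induction S using Finset.induction_on with
  | empty =>
    intro τ _ hS
    obtain rfl : τ = 1 := Equiv.ext fun x => hS x (by simp)
    exact G.one_mem
  | insert y S _ ih =>
    intro τ hτ hS
    obtain ⟨s, hsG, hsπ, hs, hs'⟩ := hG y
    by_cases hy : ∀ x, π x = y → τ x = x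
    · exact ih τ hτ fun x hx => by
        by_cases h : π x = y
        · exact hy x h
        · exact hS x (by simp [h, hx])
    · push Not at hy
      obtain ⟨x₀, rfl, hx₀⟩ := hy
      have hmove : ∀ x, π x = π x₀ → τ x ≠ x := by
        intro x hx hfix
        have hne : x ≠ x₀ := by rintro rfl; exact hx₀ hfix
        exact hne (τ.injective
          (hfix.trans (eq_of_ne_of_card_fiber_eq_two hcard hx (hτ x₀) hne hx₀)))
      rw [← mul_mem_cancel_left hsG]
      refine ih _ (fun x => by simp [hsπ, hτ]) fun x hx => ?_
      by_cases h : π x = π x₀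
      · exact eq_of_ne_of_card_fiber_eq_two hcard (hsπ (τ x)) (hτ x).symm
          (hs' _ ((hτ x).trans h)) (hmove x h).symm
      · rw [Equiv.Perm.mul_apply, hS x (by simp [h, hx]), hs x h]

/-- Let `Γ` act on `X` and transitively on `Y`, compatibly with a map `X → Y` whose fibres have two
points, and through `H` on `Y`. If some element of `Γ` acts on `X` as the swap of a single fibre,
then `Γ` acts on `X` through the full wreath product `C₂ ≀ H`. -/
theorem isPermIsomorphic_wreathProduct {Γ X Y Δ : Type*} [Group Γ] [Finite Y] {π : X → Y}
    (hcard : ∀ y, Nat.card {x // π x = y} = 2) (ρX : Γ →* Equiv.Perm X) (ρY : Γ →* Equiv.Perm Y)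
    (hequiv : ∀ γ x, π (ρX γ x) = ρY γ (π x)) (htrans : ∀ y y', ∃ γ, ρY γ y = y')
    {H : Subgroup (Equiv.Perm Δ)} (hH : IsPermIsomorphic ρY.range H)
    {γ₀ : Γ} {x₀ : X} (hγ₀ : ρX γ₀ x₀ ≠ x₀) (hγ₀Y : ρY γ₀ = 1)
    (hγ₀X : ∀ x, π x ≠ π x₀ → ρX γ₀ x = x) :
    IsPermIsomorphic ρX.range (wreathProduct (⊤ : Subgroup (Equiv.Perm (Fin 2))) H) := by
  have hmem : ∀ τ : Equiv.Perm X, (∀ x, π (τ x) = π x) → τ ∈ ρX.range := by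
    refine Equiv.Perm.mem_of_preserves_fibers hcard fun y => ?_
    -- conjugating `γ₀` moves its swap to the fibre over `y`
    obtain ⟨γ, rfl⟩ := htrans (π x₀) y
    have hconj : ∀ x, ρX (γ * γ₀ * γ⁻¹) x = ρX γ (ρX γ₀ ((ρX γ)⁻¹ x)) := fun x => by simp
    have hπ : ∀ x, π ((ρX γ)⁻¹ x) = (ρY γ)⁻¹ (π x) := fun x => by
      rw [← map_inv, hequiv, map_inv]
    refine ⟨_, ⟨γ * γ₀ * γ⁻¹, rfl⟩, fun x => ?_, fun x hx => ?_, fun x hx h => ?_⟩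
    · rw [hconj, hequiv, hequiv, hπ, hγ₀Y]
      simp
    · rw [hconj, hγ₀X _ fun h => hx (by rw [← h, hπ]; simp)]
      simp
    · rw [hconj, ← Equiv.Perm.eq_inv_iff_eq] at h
      have hx' : π ((ρX γ)⁻¹ x) = π x₀ := by rw [hπ, hx]; simp
      have hne : (ρX γ)⁻¹ x ≠ x₀ := fun h' => hγ₀ (by rwa [h'] at h)
      have heq : (ρX γ)⁻¹ x = ρX γ₀ x₀ :=
        eq_of_ne_of_card_fiber_eq_two hcard hx' (by simp [hequiv, hγ₀Y]) hne hγ₀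
      exact hne ((ρX γ₀).injective (h.trans heq))
  obtain ⟨e, rfl⟩ := hH
  have ε : ∀ y, {x // π x = y} ≃ Fin 2 := fun y =>
    have : Finite {x // π x = y} := Nat.finite_of_card_ne_zero (by rw [hcard]; exact two_ne_zero)
    Finite.equivFinOfCardEq (hcard y)
  -- coordinates on `X`: the point of `Δ` below, and a chosen labelling of each fibre
  let f : X ≃ Δ × Fin 2 := (Equiv.sigmaFiberEquiv π).symm.trans <|
    (Equiv.sigmaCongrRight ε).trans <|
      (Equiv.sigmaEquivProd Y (Fin 2)).trans (e.prodCongr (Equiv.refl _))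
  have hf : ∀ x, (f x).1 = e (π x) := fun _ => rfl
  have hfsymm : ∀ q, π (f.symm q) = e.symm q.1 := fun q => by
    rw [Equiv.eq_symm_apply, ← hf, Equiv.apply_symm_apply]
  refine ⟨f, le_antisymm ?_ ?_⟩
  · rintro _ ⟨_, ⟨γ, rfl⟩, rfl⟩
    have hfst : ∀ q, (f (ρX γ (f.symm q))).1 = e (ρY γ (e.symm q.1)) := fun q => by
      rw [hf, hequiv, hfsymm]
    have hinj : ∀ i, Function.Injective fun l => (f (ρX γ (f.symm (i, l)))).2 := by
      intro i l l' h
      have : f (ρX γ (f.symm (i, l))) = f (ρX γ (f.symm (i, l'))) :=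
        Prod.ext (by rw [hfst, hfst]) h
      simpa using this
    refine ⟨e.permCongrHom (ρY γ), ⟨_, ⟨γ, rfl⟩, rfl⟩,
      fun i => Equiv.ofBijective _ (Finite.injective_iff_bijective.1 (hinj i)),
      fun _ => Subgroup.mem_top _, fun i l => Prod.ext (hfst (i, l)) rfl⟩
  · rintro σ ⟨_, ⟨_, ⟨γ, rfl⟩, rfl⟩, a, -, hσ⟩
    have hσfst : ∀ q, (σ q).1 = e (ρY γ (e.symm q.1)) := fun q => by
      rw [← Prod.mk.eta (p := q), hσ]; rfl
    -- `σ` and `γ` act in the same way on the fibres, so they differ by an element of the kernel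
    have h := hmem ((ρX γ)⁻¹ * f.symm.permCongrHom σ) fun x => by
      have h1 : f.symm.permCongrHom σ x = f.symm (σ (f x)) := rfl
      rw [Equiv.Perm.mul_apply, ← map_inv, hequiv, h1, hfsymm, hσfst, hf]
      simp
    rw [mul_mem_cancel_left (inv_mem (MonoidHom.mem_range.2 ⟨γ, rfl⟩))] at h
    exact ⟨_, h, by ext q <;> simp [Equiv.permCongrHom]⟩

/-! ### The Galois group of a quadratic extension -/

theorem mainTheorem9
    (k K L : Type*) [Field k] [NumberField k] [Field K] [NumberField K] [Field L] [NumberField L]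
    [Algebra k K] [Algebra K L] [Algebra k L] [IsScalarTower k K L]
    (d : ℕ) (H : Subgroup (Equiv.Perm (Fin d)))
    (α : K) (hα : k⟮α⟯ = ⊤) (hH : IsPermIsomorphic (galPermGroup k α) H)
    (hL : Module.finrank K L = 2)
    (p : ℕ) (hp : p.Prime)
    (hunram : ∀ P : Ideal (𝓞 K), ∀ _ : P.IsPrime, (p : 𝓞 K) ∈ P → Algebra.IsUnramifiedAt (𝓞 k) P)
    (hdvd : p ∣ Ideal.absNorm (relDiscr K L))
    (hndvd : ¬ p ^ 2 ∣ Ideal.absNorm (relDiscr K L))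
    (β : L) (hβ : k⟮β⟯ = ⊤) :
    IsPermIsomorphic (galPermGroup k β)
      (wreathProduct (⊤ : Subgroup (Equiv.Perm (Fin 2))) H) := by
  -- the absolute norm of the relative discriminant is that of the different
  rw [relDiscr, Ideal.absNorm_relNorm] at hdvd hndvd
  have : FiniteDimensional k K := .right ℚ k K
  have : FiniteDimensional k L := .right ℚ k L
  have : FiniteDimensional K L := .right ℚ K L
  obtain ⟨σ, ψ₀, hσψ₀, hσK, hσL⟩ :=
    exists_embeddingPerm_moving_one_fiber hp hunram hdvd hndvd
  refine (isPermIsomorphic_range_embeddingPerm_galPermGroup hβ).symm.trans ?_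
  exact isPermIsomorphic_wreathProduct
    (π := fun ψ : L →ₐ[k] AlgebraicClosure k => ψ.comp (IsScalarTower.toAlgHom k K L))
    (fun φ => (card_fiber_restriction φ).trans hL)
    (embeddingPerm k L _) (embeddingPerm k K _) (fun _ _ => rfl) exists_embeddingPerm_apply_eq
    ((isPermIsomorphic_range_embeddingPerm_galPermGroup hα).trans hH) hσψ₀ hσK hσL
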